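/- Let $(X,\mathcal B,\mu)$ be a $\sigma$-finite measure space, $1\le p<\infty$, and let $f:X\to X$ be a bijection with $f(B),f^{-1}(B)\in\mathcal B$ for every $B\in\mathcal B$, which is non-singular ($\mu(f^{-1}(B))=0$ if and only if $\mu(B)=0$, for $B\in\mathcal B$) and satisfies, for some constant $c>0$, $\mu(f^{-1}(B))\le c\,\mu(B)$ for every $B\in\mathcal B$. Let $T_f\varphi=\varphi\circ f$ be the induced bounded composition operator on the complex space $L^p(X,\mathcal B,\mu)$, and suppose that $T_f$ is invertible (as a bounded operator). Suppose that the system is dissipative and of bounded distortion, generated by $W$: that is, $W\in\mathcal B$, $0<\mu(W)<\infty$, $X$ is the disjoint union of the sets $f^k(W)$, $k\in\mathbb Z$, and there is $K>0$ such that $$\tfrac1K\,\mu(f^k(W))\,\mu(B)\le\mu(f^k(B))\,\mu(W)\le K\,\mu(f^k(W))\,\mu(B)$$ for all $k\in\mathbb Z$ and all measurable $B\subseteq W$. Then $\sup_{n\ge 1}\mu(f^{-n}(W))=\infty$ if and only if $T_f$ is positively expansive, i.e. for every $\varphi$ with $\|\varphi\|_p=1$ there is an integer $n\ge1$ with $\|T_f^n\varphi\|_p\ge2$.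 If $\sup_{n\ge1}\mu(f^{-n}(W))=\infty$, then $T_f$ is strongly structurally stable if and only if it has the shadowing property. Here an invertible bounded operator $T$ on a complex Banach space $E$ has the shadowing property if for every $\varepsilon>0$ there is $\delta>0$ such that for every sequence $(x_n)_{n\in\mathbb Z}$ in $E$ with $\|Tx_n-x_{n+1}\|\le\delta$ for all $n\in\mathbb Z$ there is $x\in E$ with $\|T^nx-x_n\|<\varepsilon$ for all $n\in\mathbb Z$; and $T$ is strongly structurally stable if for every $\gamma>0$ there is $\varepsilon>0$ such that for every bounded Lipschitz map $\phi:E\to E$ with $\|\phi\|_\infty\le\varepsilon$ and $\mathrm{Lip}(\phi)\le\varepsilon$ there is a homeomorphism $h:E\to E$ with $h\circ T=(T+\phi)\circ h$ and $\|h-I\|_\infty\le\gamma$. -/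

import Mathlib

open MeasureTheory
open scoped ENNReal NNReal BoundedContinuousFunction

namespace LinearDynamics

section Operators

variable {E : Type*} [NormedAddCommGroup E] [NormedSpace ℂ E]

/-- `T` is positively expansive: every unit vector `x` satisfies `‖Tⁿ x‖ ≥ 2` for some positive
integer `n`. -/
def PositivelyExpansive (T : E →L[ℂ] E) : Prop :=
  ∀ x : E, ‖x‖ = 1 → ∃ n : ℕ, 1 ≤ n ∧ 2 ≤ ‖(T ^ n) x‖

/-- The shadowing property of an invertible operator: for every `ε > 0` there is `δ > 0` such that
every two-sided `δ`-pseudotrajectory is `ε`-shadowed by a real trajectory. -/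
def HasShadowingProperty (T : E ≃L[ℂ] E) : Prop :=
  ∀ ε : ℝ, 0 < ε → ∃ δ : ℝ, 0 < δ ∧
    ∀ x : ℤ → E, (∀ n : ℤ, ‖T (x n) - x (n + 1)‖ ≤ δ) →
      ∃ y : E, ∀ n : ℤ, ‖(T ^ n) y - x n‖ < ε

/-- Strong structural stability of an invertible operator: for every `γ > 0` there is `ε > 0` such
that for every bounded Lipschitz map `φ` with `‖φ‖_∞ ≤ ε` and `Lip(φ) ≤ ε` there is a homeomorphism
`h` with `h ∘ T = (T + φ) ∘ h` and `‖h - I‖_∞ ≤ γ`. -/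
def StronglyStructurallyStable (T : E ≃L[ℂ] E) : Prop :=
  ∀ γ : ℝ, 0 < γ → ∃ ε : ℝ≥0, 0 < ε ∧
    ∀ φ : E →ᵇ E, ‖φ‖ ≤ ε → LipschitzWith ε φ →
      ∃ h : E ≃ₜ E, (∀ x : E, h (T x) = T (h x) + φ (h x)) ∧ ∀ x : E, ‖h x - x‖ ≤ γ

end Operators

section Composition

variable {X : Type*} [MeasurableSpace X]

/-- The condition `μ(f⁻¹(B)) ≤ c μ(B)` for all measurable `B`, for some finite constant `c > 0`. -/
def CompositionBounded (f : X ≃ᵐ X) (μ : Measure X) : Prop :=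
  ∃ c : ℝ≥0, 0 < c ∧ ∀ B : Set X, MeasurableSet B → μ (f ⁻¹' B) ≤ c * μ B

variable {f : X ≃ᵐ X} {μ : Measure X}

theorem CompositionBounded.exists_map_le (h : CompositionBounded f μ) :
    ∃ c : ℝ≥0, 0 < c ∧ μ.map f ≤ (c : ℝ≥0∞) • μ := by
  obtain ⟨c, hc, h⟩ := h
  refine ⟨c, hc, Measure.le_iff.2 fun B hB => ?_⟩
  rw [Measure.map_apply f.measurable hB]
  simpa using h B hB

theorem CompositionBounded.quasiMeasurePreserving (h : CompositionBounded f μ) :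
    Measure.QuasiMeasurePreserving f μ μ := by
  obtain ⟨c, -, h⟩ := h.exists_map_le
  exact ⟨f.measurable, Measure.absolutelyContinuous_of_le_smul h⟩

theorem CompositionBounded.exists_eLpNorm_comp_le (h : CompositionBounded f μ) (p : ℝ≥0∞) :
    ∃ C : ℝ≥0, ∀ g : X → ℂ, AEStronglyMeasurable g μ →
      eLpNorm (g ∘ f) p μ ≤ C * eLpNorm g p μ := by
  obtain ⟨c, hc, hle⟩ := h.exists_map_le
  refine ⟨c ^ (1 / p).toReal, fun g hg => ?_⟩
  have hg' : AEStronglyMeasurable g (μ.map f) :=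
    hg.mono_ac h.quasiMeasurePreserving.absolutelyContinuous
  rw [← eLpNorm_map_measure hg' f.measurable.aemeasurable]
  refine (eLpNorm_mono_measure g hle).trans ?_
  rw [eLpNorm_smul_measure_of_ne_zero (by exact_mod_cast hc.ne'), smul_eq_mul,
    ENNReal.coe_rpow_of_nonneg _ ENNReal.toReal_nonneg]

theorem CompositionBounded.memLp_comp (h : CompositionBounded f μ) {p : ℝ≥0∞} {g : X → ℂ}
    (hg : MemLp g p μ) : MemLp (g ∘ f) p μ := by
  obtain ⟨C, hC⟩ := h.exists_eLpNorm_comp_le p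
  exact ⟨hg.1.comp_quasiMeasurePreserving h.quasiMeasurePreserving,
    (hC g hg.1).trans_lt (ENNReal.mul_lt_top ENNReal.coe_lt_top hg.2)⟩

/-- The composition operator `T_f : φ ↦ φ ∘ f` as a linear map of the complex space `L^p(μ)`. -/
noncomputable def compositionLinearMap (p : ℝ≥0∞) (h : CompositionBounded f μ) :
    Lp ℂ p μ →ₗ[ℂ] Lp ℂ p μ where
  toFun φ := (h.memLp_comp (Lp.memLp φ)).toLp (φ ∘ f)
  map_add' φ ψ := by
    rw [← MemLp.toLp_add]
    refine MemLp.toLp_congr _ _ ?_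
    exact h.quasiMeasurePreserving.ae_eq_comp (Lp.coeFn_add φ ψ)
  map_smul' a φ := by
    rw [RingHom.id_apply, ← MemLp.toLp_const_smul]
    refine MemLp.toLp_congr _ _ ?_
    exact h.quasiMeasurePreserving.ae_eq_comp (Lp.coeFn_smul a φ)

theorem exists_norm_compositionLinearMap_le (p : ℝ≥0∞) [Fact (1 ≤ p)]
    (h : CompositionBounded f μ) :
    ∃ C : ℝ, ∀ φ : Lp ℂ p μ, ‖compositionLinearMap p h φ‖ ≤ C * ‖φ‖ := by
  obtain ⟨C, hC⟩ := h.exists_eLpNorm_comp_le p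
  refine ⟨C, fun φ => ?_⟩
  change ‖(h.memLp_comp (Lp.memLp φ)).toLp (φ ∘ f)‖ ≤ _
  rw [Lp.norm_toLp, Lp.norm_def, ← ENNReal.coe_toReal, ← ENNReal.toReal_mul]
  exact ENNReal.toReal_mono (ENNReal.mul_ne_top ENNReal.coe_ne_top (Lp.eLpNorm_ne_top φ))
    (hC φ (Lp.aestronglyMeasurable φ))

/-- The composition operator `T_f : φ ↦ φ ∘ f` as a bounded operator on the complex space
`L^p(μ)`. -/
noncomputable def compositionOperator (p : ℝ≥0∞) [Fact (1 ≤ p)] (h : CompositionBounded f μ) :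
    Lp ℂ p μ →L[ℂ] Lp ℂ p μ :=
  (compositionLinearMap p h).mkContinuousOfExistsBound (exists_norm_compositionLinearMap_le p h)

theorem compositionOperator_ae_eq (p : ℝ≥0∞) [Fact (1 ≤ p)] (h : CompositionBounded f μ)
    (φ : Lp ℂ p μ) : compositionOperator p h φ =ᵐ[μ] φ ∘ f :=
  MemLp.coeFn_toLp (h.memLp_comp (Lp.memLp φ))

end Composition

section Dissipative

variable {X : Type*} [MeasurableSpace X]

/-- The image `f^k(A)`, for an integer `k`, of a set under an invertible transformation. -/
def iterImage (f : X ≃ᵐ X) (k : ℤ) (A : Set X) : Set X :=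
  ((f.toEquiv : Equiv.Perm X) ^ k) '' A

/-- `(X, μ, f)` is a dissipative system generated by `W`: `f` is invertible and non-singular,
`0 < μ(W) < ∞`, and `X` is the disjoint union of the sets `f^k(W)`, `k ∈ ℤ`. -/
structure IsDissipativeSystem (f : X ≃ᵐ X) (μ : Measure X) (W : Set X) : Prop where
  nonsingular : ∀ B : Set X, MeasurableSet B → (μ (f ⁻¹' B) = 0 ↔ μ B = 0)
  measurableSet : MeasurableSet W
  measure_pos : 0 < μ W
  measure_lt_top : μ W < ∞
  pairwise_disjoint : ∀ j k : ℤ, j ≠ k → Disjoint (iterImage f j W) (iterImage f k W)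
  iUnion_eq : ⋃ k : ℤ, iterImage f k W = Set.univ

/-- Bounded distortion on `W`: for some `K > 0`,
`(1/K) μ(f^k(W)) μ(B) ≤ μ(f^k(B)) μ(W) ≤ K μ(f^k(W)) μ(B)` for all `k ∈ ℤ` and all measurable
`B ⊆ W`. -/
def HasBoundedDistortion (f : X ≃ᵐ X) (μ : Measure X) (W : Set X) : Prop :=
  ∃ K : ℝ≥0, 0 < K ∧ ∀ (k : ℤ) (B : Set X), MeasurableSet B → B ⊆ W →
    (K : ℝ≥0∞)⁻¹ * (μ (iterImage f k W) * μ B) ≤ μ (iterImage f k B) * μ W ∧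
    μ (iterImage f k B) * μ W ≤ K * (μ (iterImage f k W) * μ B)

end Dissipative

end LinearDynamics

open LinearDynamics

/-! Write `a k = μ (f^k W)`. Bounded distortion says that, up to constants, `T^n` rescales the
`p`-th power of the norm on `f^k W` by `a (k - n) / a k`. If the `a (-n)` are unbounded, any nonzero
part of a vector on some level `f^k W` is eventually inflated. If they are bounded, the indicator of
a level `f^(-j) W` with `a (-j)` above half the supremum never doubles its norm.

For the second claim, both properties are equivalent, under positive expansivity, to summability of
`‖T^(-n)‖`. Each yields bounded solutions of `y (n + 1) = T (y n) + z n` for small finitely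
supported `z` in a dense invariant subspace: shadowing directly, structural stability by realising
`z` as a small perturbation along a well-separated forced orbit
(`StronglyStructurallyStable.hasBoundedSolutions`). Positive expansivity makes a bounded forward
orbit vanish, so a forcing at negative times has only one bounded solution. Testing forcings along a
backward orbit then bounds `‖T^(-n)‖`, and next makes it at most `1/2` for some `n`
(`HasBoundedSolutions.summable_norm_symm_pow`). Conversely, summability gives shadowing by an
explicit series and structural stability by a contraction argument. -/

namespace LinearDynamics

/-! ### Bounded solutions, summable inverse powers and shadowing -/

section Abstract

variable {E : Type*} [NormedAddCommGroup E] [NormedSpace ℂ E]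

/-- For some `δ > 0`, every finitely supported forcing `z` with values in `D` and `‖z n‖ ≤ δ` admits
a solution of `y (n + 1) = T (y n) + z n` bounded by `1`. -/
def HasBoundedSolutions (T : E ≃L[ℂ] E) (D : Set E) : Prop :=
  ∃ δ : ℝ, 0 < δ ∧ ∀ z : ℤ → E, z.support.Finite → (∀ n, z n ∈ D) → (∀ n, ‖z n‖ ≤ δ) →
    ∃ y : ℤ → E, (∀ n, ‖y n‖ ≤ 1) ∧ ∀ n, y (n + 1) = T (y n) + z n

theorem zpow_add_one_apply (T : E ≃L[ℂ] E) (n : ℤ) (x : E) : (T ^ (n + 1)) x = T ((T ^ n) x) := by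
  rw [add_comm, zpow_one_add]; rfl

theorem zpow_add_apply (T : E ≃L[ℂ] E) (m n : ℤ) (x : E) :
    (T ^ (m + n)) x = (T ^ m) ((T ^ n) x) := by
  rw [zpow_add]; rfl

theorem zpow_natCast_apply (T : E ≃L[ℂ] E) (n : ℕ) (x : E) :
    (T ^ (n : ℤ)) x = ((T : E →L[ℂ] E) ^ n) x := by
  induction n with
  | zero => rfl
  | succ n ih => rw [Nat.cast_succ, zpow_add_one_apply, ih, pow_succ']; rfl

theorem pow_succ_symm_apply (T : E ≃L[ℂ] E) (n : ℕ) (x : E) :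
    ((T.symm : E →L[ℂ] E) ^ (n + 1)) x = T.symm (((T.symm : E →L[ℂ] E) ^ n) x) := by
  rw [pow_succ']; rfl

theorem pow_succ_symm_apply' (T : E ≃L[ℂ] E) (n : ℕ) (x : E) :
    ((T.symm : E →L[ℂ] E) ^ (n + 1)) x = ((T.symm : E →L[ℂ] E) ^ n) (T.symm x) := by
  rw [pow_succ]; rfl

/-- Variation of constants: `s n` sums `T^(-k-1) (z k)` over `k < n`, so finite support leaves
finitely many values. The free vector `v` is the homogeneous solution; it is zero for shadowing and
a large separating vector for structural stability. -/
theorem exists_zpow_forced_orbit (T : E ≃L[ℂ] E) (z : ℤ → E) (hz : z.support.Finite) :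
    ∃ s : ℤ → E, (Set.range s).Finite ∧
      (∀ n, s n ∈ Submodule.span ℂ {v | ∃ k, v = (T ^ (-k - 1)) (z k)}) ∧
      ∀ n v, (T ^ (n + 1)) (s (n + 1) + v) = T ((T ^ n) (s n + v)) + z n := by
  classical
  refine ⟨fun n => ∑ k ∈ hz.toFinset.filter (· < n), (T ^ (-k - 1)) (z k), ?_, ?_, ?_⟩
  · refine (Finset.finite_toSet (hz.toFinset.powerset.image
      fun F => ∑ k ∈ F, (T ^ (-k - 1)) (z k))).subset ?_
    rintro _ ⟨n, rfl⟩
    simp only [Finset.coe_image, Set.mem_image, Finset.mem_coe, Finset.mem_powerset]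
    exact ⟨_, Finset.filter_subset _ _, rfl⟩
  · exact fun n => Submodule.sum_mem _ fun k _ => Submodule.subset_span ⟨k, rfl⟩
  · intro n v
    have key : ∑ k ∈ hz.toFinset.filter (· < n + 1), (T ^ (-k - 1)) (z k) =
        ∑ k ∈ hz.toFinset.filter (· < n), (T ^ (-k - 1)) (z k) + (T ^ (-n - 1)) (z n) := by
      by_cases hn : z n = 0
      · rw [hn, map_zero, add_zero]
        refine Finset.sum_congr (Finset.filter_congr fun k hk => ?_) fun _ _ => rfl
        have : k ≠ n := by rintro rfl; simp [hn] at hk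
        omega
      · rw [show hz.toFinset.filter (· < n + 1) = insert n (hz.toFinset.filter (· < n)) by
            ext k; simp only [Finset.mem_filter, Set.Finite.mem_toFinset, Function.mem_support,
              Finset.mem_insert]
            constructor
            · rintro ⟨h1, h2⟩
              rcases eq_or_ne k n with h | h
              · exact Or.inl h
              · exact Or.inr ⟨h1, by omega⟩
            · rintro (rfl | ⟨h1, h2⟩)
              · exact ⟨hn, by omega⟩
              · exact ⟨h1, by omega⟩,
          Finset.sum_insert (by simp), add_comm]
    simp only [key]
    rw [add_right_comm, map_add, ← zpow_add_apply, zpow_add_one_apply,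
      show n + 1 + (-n - 1) = 0 by ring, zpow_zero]
    rfl

/-- A forced orbit is a pseudotrajectory with defect `z`; subtracting the true orbit that shadows it
leaves a bounded solution. -/
theorem HasShadowingProperty.hasBoundedSolutions {T : E ≃L[ℂ] E} (h : HasShadowingProperty T)
    (D : Set E) : HasBoundedSolutions T D := by
  obtain ⟨δ, hδ, h⟩ := h 1 one_pos
  refine ⟨δ, hδ, fun z hz _ hzδ => ?_⟩
  obtain ⟨s, -, -, hs⟩ := exists_zpow_forced_orbit T z hz
  simp only [forall_comm (α := ℤ) (β := E)] at hs
  replace hs := hs 0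
  simp only [add_zero] at hs
  obtain ⟨y, hy⟩ := h (fun n => (T ^ n) (s n)) fun n => by
    rw [hs, sub_add_cancel_left, norm_neg]; exact hzδ n
  refine ⟨fun n => (T ^ n) (s n) - (T ^ n) y, fun n => ?_, fun n => ?_⟩
  · rw [norm_sub_rev]; exact (hy n).le
  · dsimp only
    rw [hs, zpow_add_one_apply, map_sub]; abel

theorem PositivelyExpansive.exists_two_mul_norm_le {T : E →L[ℂ] E} (h : PositivelyExpansive T)
    {v : E} (hv : v ≠ 0) : ∃ n : ℕ, 1 ≤ n ∧ 2 * ‖v‖ ≤ ‖(T ^ n) v‖ := by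
  have hv' : 0 < ‖v‖ := norm_pos_iff.2 hv
  obtain ⟨n, hn, h2⟩ := h (((‖v‖⁻¹ : ℝ) : ℂ) • v) (by
    rw [norm_smul, Complex.norm_real, norm_inv, norm_norm, inv_mul_cancel₀ hv'.ne'])
  refine ⟨n, hn, ?_⟩
  rw [map_smul, norm_smul, Complex.norm_real, norm_inv, norm_norm, inv_mul_eq_div,
    le_div_iff₀ hv'] at h2
  exact h2

/-- Expansivity can be applied again at the point already reached, so a nonzero orbit doubles its
norm arbitrarily often. -/
theorem PositivelyExpansive.eq_zero_of_bounded {T : E →L[ℂ] E} (h : PositivelyExpansive T)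
    {v : E} {C : ℝ} (hC : ∀ n : ℕ, ‖(T ^ n) v‖ ≤ C) : v = 0 := by
  by_contra hv
  have key : ∀ k : ℕ, ∃ n : ℕ, 2 ^ k * ‖v‖ ≤ ‖(T ^ n) v‖ := by
    intro k
    induction k with
    | zero => exact ⟨0, by simp⟩
    | succ k ih =>
      obtain ⟨n, hn⟩ := ih
      have hne : (T ^ n) v ≠ 0 := by
        intro h0
        rw [h0, norm_zero] at hn
        have := norm_pos_iff.2 hv
        have : 0 < 2 ^ k * ‖v‖ := by positivity
        linarith
      obtain ⟨m, -, hm⟩ := h.exists_two_mul_norm_le hne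
      refine ⟨m + n, ?_⟩
      rw [pow_add T, mul_apply_eq_comp]
      refine le_trans ?_ hm
      rw [pow_succ]
      linarith
  have hv' : 0 < ‖v‖ := norm_pos_iff.2 hv
  obtain ⟨k, hk⟩ := pow_unbounded_of_one_lt (C / ‖v‖) one_lt_two
  obtain ⟨n, hn⟩ := key k
  rw [div_lt_iff₀ hv'] at hk
  exact absurd (hn.trans (hC n)) (not_le.2 hk)

/-- A forcing along a backward orbit is solved by partial sums. -/
theorem norm_sum_smul_symm_pow_le {T : E ≃L[ℂ] E} (hT : PositivelyExpansive (T : E →L[ℂ] E))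
    {D : Submodule ℂ E} (hD : ∀ x ∈ D, T.symm x ∈ D) {δ : ℝ}
    (h : ∀ z : ℤ → E, z.support.Finite → (∀ n, z n ∈ D) → (∀ n, ‖z n‖ ≤ δ) →
      ∃ y : ℤ → E, (∀ n, ‖y n‖ ≤ 1) ∧ ∀ n, y (n + 1) = T (y n) + z n) (hδ : 0 ≤ δ)
    {x : E} (hx : x ∈ D) (c : ℕ → ℂ) (N : ℕ) (hcN : ∀ n, N ≤ n → c n = 0)
    (hc : ∀ n, ‖c n • ((T.symm : E →L[ℂ] E) ^ n) x‖ ≤ δ) (n : ℕ) :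
    ‖(∑ i ∈ Finset.range n, c i) • ((T.symm : E →L[ℂ] E) ^ n) x‖ ≤ 1 := by
  have hDn : ∀ n, ((T.symm : E →L[ℂ] E) ^ n) x ∈ D := by
    intro n
    induction n with
    | zero => exact hx
    | succ n ih => rw [pow_succ_symm_apply]; exact hD _ ih
  -- The forcing at time `-(i + 1)` is `c i • T^(-i) x`; nothing acts at times `n ≥ 0`.
  set z : ℤ → E := fun n => if n < 0 then
    c (-n - 1).toNat • ((T.symm : E →L[ℂ] E) ^ (-n - 1).toNat) x else 0 with hz
  obtain ⟨y, hy1, hy⟩ := h z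
    ((Set.finite_Icc (-N : ℤ) 0).subset fun n hn => by
      rw [Function.mem_support, hz] at hn
      simp only [ne_eq, ite_eq_right_iff, Classical.not_imp] at hn
      refine ⟨?_, hn.1.le⟩
      by_contra hlt
      exact hn.2 (by rw [hcN _ (by omega), zero_smul]))
    (fun n => by
      simp only [hz]; split_ifs
      · exact D.smul_mem _ (hDn _)
      · exact D.zero_mem)
    (fun n => by
      simp only [hz]; split_ifs
      · exact hc _
      · simpa using hδ)
  -- From time `0` on, `y` is a free bounded orbit, so expansivity kills it; the values at negative
  -- times are then forced.
  have hy0 : y 0 = 0 := by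
    have hfw : ∀ n : ℕ, y n = ((T : E →L[ℂ] E) ^ n) (y 0) := by
      intro n
      induction n with
      | zero => rfl
      | succ n ih =>
        rw [Nat.cast_succ, hy, ih, pow_succ']
        simp [hz]
    exact hT.eq_zero_of_bounded (C := 1) fun n => by rw [← hfw]; exact hy1 _
  have hbw : ∀ n : ℕ, y (-n) = -((∑ i ∈ Finset.range n, c i) • ((T.symm : E →L[ℂ] E) ^ n) x) := by
    intro n
    induction n with
    | zero => simp [hy0]
    | succ n ih =>
      have h1 := hy (-(n + 1 : ℕ))
      have hzn : z (-(n + 1 : ℕ)) = c n • ((T.symm : E →L[ℂ] E) ^ n) x := by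
        simp only [hz]
        rw [if_pos (by omega), show (-(-((n + 1 : ℕ) : ℤ)) - 1).toNat = n by omega]
      rw [show (-((n + 1 : ℕ) : ℤ) + 1) = -(n : ℤ) by push_cast; ring, ih, hzn] at h1
      have h2 : T (y (-(n + 1 : ℕ))) =
          -((∑ i ∈ Finset.range (n + 1), c i) • ((T.symm : E →L[ℂ] E) ^ n) x) := by
        rw [← sub_eq_iff_eq_add] at h1
        rw [← h1, Finset.sum_range_succ, add_smul]; abel
      rw [pow_succ_symm_apply, ← map_smul, ← map_neg, ← h2, T.symm_apply_apply]
  rw [← norm_neg, ← hbw]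
  exact hy1 _

/-- The partial sums satisfy `S m ≤ S N + S m / 2`, hence stay below `2 * S N`. -/
theorem summable_norm_pow_of_norm_pow_le {A : E →L[ℂ] E} {N : ℕ} (hN : ‖A ^ N‖ ≤ 1 / 2) :
    Summable fun n => ‖A ^ n‖ := by
  refine summable_of_sum_range_le (c := 2 * ∑ n ∈ Finset.range N, ‖A ^ n‖)
    (fun _ => norm_nonneg _) fun m => ?_
  have h1 : ∑ n ∈ Finset.range m, ‖A ^ n‖ ≤ ∑ n ∈ Finset.range (N + m), ‖A ^ n‖ :=
    Finset.sum_le_sum_of_subset_of_nonneg (Finset.range_mono (by omega))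
      fun _ _ _ => norm_nonneg _
  rw [Finset.sum_range_add] at h1
  have h2 : ∑ n ∈ Finset.range m, ‖A ^ (N + n)‖ ≤ 1 / 2 * ∑ n ∈ Finset.range m, ‖A ^ n‖ := by
    rw [Finset.mul_sum]
    refine Finset.sum_le_sum fun n _ => ?_
    rw [pow_add]
    exact (norm_mul_le _ _).trans (mul_le_mul_of_nonneg_right hN (norm_nonneg _))
  linarith

theorem opNorm_le_of_dense {A : E →L[ℂ] E} {D : Submodule ℂ E} (hD : Dense (D : Set E))
    {r C : ℝ} (hr : 0 < r) (hC : 0 ≤ C) (h : ∀ x ∈ D, ‖x‖ ≤ r → ‖A x‖ ≤ C) : ‖A‖ ≤ C / r := by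
  refine A.opNorm_le_bound (by positivity) fun x => ?_
  refine hD.induction (P := fun x => ‖A x‖ ≤ C / r * ‖x‖) ?_
    (isClosed_le (by fun_prop) (by fun_prop)) x
  intro x hx
  rcases eq_or_ne x 0 with rfl | hx0
  · simp
  have hx' : 0 < ‖x‖ := norm_pos_iff.2 hx0
  have := h (((r / ‖x‖ : ℝ) : ℂ) • x) (D.smul_mem _ hx) (by
    rw [norm_smul, Complex.norm_real, norm_div, norm_norm, Real.norm_of_nonneg hr.le,
      div_mul_cancel₀ _ hx'.ne'])
  rw [map_smul, norm_smul, Complex.norm_real, norm_div, norm_norm, Real.norm_of_nonneg hr.le] at this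
  rw [div_mul_eq_mul_div, div_le_iff₀ hx'] at this
  rw [div_mul_eq_mul_div, le_div_iff₀ hr]
  linarith

/-- Two test forcings suffice: a single impulse gives power-boundedness of the inverse, and `N`
equal impulses pile up to `N • T^(-N) x`, still bounded by `1`, which gives decay of order `1 / N`.
-/
theorem HasBoundedSolutions.summable_norm_symm_pow {T : E ≃L[ℂ] E} {D : Submodule ℂ E}
    (h : HasBoundedSolutions T (D : Set E)) (hT : PositivelyExpansive (T : E →L[ℂ] E))
    (hD : ∀ x ∈ D, T.symm x ∈ D) (hdense : Dense (D : Set E)) :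
    Summable fun n => ‖(T.symm : E →L[ℂ] E) ^ n‖ := by
  obtain ⟨δ, hδ, h⟩ := h
  have hb : ∀ n : ℕ, 1 ≤ n → ‖(T.symm : E →L[ℂ] E) ^ n‖ ≤ 1 / δ := by
    intro n hn
    refine opNorm_le_of_dense hdense hδ zero_le_one fun x hx hxδ => ?_
    have := norm_sum_smul_symm_pow_le hT hD h hδ.le hx (fun i => if i = 0 then 1 else 0) 1
      (fun i hi => if_neg (by omega)) (fun i => by
        split_ifs with hi
        · subst hi; simpa using hxδ
        · simpa using hδ.le) n
    rwa [Finset.sum_ite_eq' _ _ fun _ => (1 : ℂ), if_pos (Finset.mem_range.2 (by omega)),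
      one_smul] at this
  set C := 1 + 1 / δ with hC
  have hCpos : 0 < C := by positivity
  have hb' : ∀ n : ℕ, ‖(T.symm : E →L[ℂ] E) ^ n‖ ≤ C := by
    intro n
    rcases n.eq_zero_or_pos with rfl | hn
    · rw [pow_zero, hC]
      exact ContinuousLinearMap.norm_id_le.trans (by simp [hδ.le])
    · exact (hb n hn).trans (by simp [hC])
  -- The bound to come is `‖T^(-N)‖ ≤ C / (N δ)`, and this `N` makes it at most `1/2`.
  obtain ⟨N, hN⟩ := exists_nat_gt (2 * (C / δ))
  have hN0 : (0 : ℝ) < N := lt_of_le_of_lt (by positivity) hN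
  refine summable_norm_pow_of_norm_pow_le (N := N) ?_
  have key : ‖(T.symm : E →L[ℂ] E) ^ N‖ ≤ (1 / N) / (δ / C) := by
    refine opNorm_le_of_dense hdense (by positivity) (by positivity) fun x hx hxδ => ?_
    have := norm_sum_smul_symm_pow_le hT hD h hδ.le hx (fun i => if i < N then 1 else 0) N
      (fun i hi => if_neg (by omega)) (fun i => by
        split_ifs with hi
        · rw [one_smul]
          calc _ ≤ _ := ContinuousLinearMap.le_opNorm _ _
            _ ≤ C * (δ / C) := mul_le_mul (hb' i) hxδ (norm_nonneg _) hCpos.le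
            _ = δ := mul_div_cancel₀ _ hCpos.ne'
        · simpa using hδ.le) N
    rw [Finset.sum_congr rfl fun i hi => if_pos (Finset.mem_range.1 hi)] at this
    simp only [Finset.sum_const, Finset.card_range, nsmul_eq_mul, mul_one, norm_smul,
      Complex.norm_natCast] at this
    rw [le_div_iff₀ hN0]
    linarith
  refine key.trans ?_
  rw [div_div, div_le_div_iff₀ (by positivity) two_pos, one_mul, one_mul]
  rw [← mul_div_assoc, div_lt_iff₀ hδ] at hN
  rw [← mul_div_assoc, le_div_iff₀ hCpos]
  exact hN.le

theorem summable_norm_symm_pow_succ {T : E ≃L[ℂ] E}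
    (hT : Summable fun n => ‖(T.symm : E →L[ℂ] E) ^ n‖) {a : ℕ → E} {C : ℝ}
    (ha : ∀ n, ‖a n‖ ≤ C) : Summable fun n => ‖((T.symm : E →L[ℂ] E) ^ (n + 1)) (a n)‖ :=
  Summable.of_nonneg_of_le (fun _ => norm_nonneg _)
    (fun n => (ContinuousLinearMap.le_opNorm _ _).trans
      (mul_le_mul_of_nonneg_left (ha n) (norm_nonneg _)))
    (((summable_nat_add_iff 1).2 hT).mul_right C)

theorem norm_tsum_symm_pow_succ_le {T : E ≃L[ℂ] E}
    (hT : Summable fun n => ‖(T.symm : E →L[ℂ] E) ^ n‖) {a : ℕ → E} {C : ℝ}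
    (ha : ∀ n, ‖a n‖ ≤ C) : ‖∑' n, ((T.symm : E →L[ℂ] E) ^ (n + 1)) (a n)‖ ≤
      (∑' n, ‖(T.symm : E →L[ℂ] E) ^ (n + 1)‖) * C := by
  rw [← tsum_mul_right]
  exact tsum_of_norm_bounded (((summable_nat_add_iff 1).2 hT).mul_right C).hasSum
    fun n => (ContinuousLinearMap.le_opNorm _ _).trans
      (mul_le_mul_of_nonneg_left (ha n) (norm_nonneg _))

variable [CompleteSpace E]

theorem map_tsum_symm_pow_succ {T : E ≃L[ℂ] E}
    (hT : Summable fun n => ‖(T.symm : E →L[ℂ] E) ^ n‖) {a : ℕ → E} {C : ℝ}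
    (ha : ∀ n, ‖a n‖ ≤ C) : T (∑' n, ((T.symm : E →L[ℂ] E) ^ (n + 1)) (a n)) =
      a 0 + ∑' n, ((T.symm : E →L[ℂ] E) ^ (n + 1)) (a (n + 1)) := by
  have hs := (summable_norm_symm_pow_succ hT ha).of_norm
  rw [T.map_tsum]
  have : ∀ n, T (((T.symm : E →L[ℂ] E) ^ (n + 1)) (a n)) = ((T.symm : E →L[ℂ] E) ^ n) (a n) :=
    fun n => by rw [pow_succ_symm_apply, T.apply_symm_apply]
  simp only [this]
  have hs' : Summable fun n => ((T.symm : E →L[ℂ] E) ^ n) (a n) := by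
    refine (summable_nat_add_iff 1).1 ?_
    exact (summable_norm_symm_pow_succ hT fun n => ha (n + 1)).of_norm
  rw [hs'.tsum_eq_zero_add, pow_zero]
  rfl

/-- With defects `e n = T (x n) - x (n + 1)`, the correction `u m = ∑ T^(-n-1) e (m + n)` solves `u
(m + 1) = T (u m) - e m`, so `x - u` is a true orbit. -/
theorem hasShadowingProperty_of_summable {T : E ≃L[ℂ] E}
    (hT : Summable fun n => ‖(T.symm : E →L[ℂ] E) ^ n‖) : HasShadowingProperty T := by
  intro ε hε
  set S := ∑' n, ‖(T.symm : E →L[ℂ] E) ^ (n + 1)‖ with hS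
  have hS0 : 0 ≤ S := tsum_nonneg fun _ => norm_nonneg _
  refine ⟨ε / (S + 1), by positivity, fun x hx => ?_⟩
  set a : ℤ → ℕ → E := fun m n => T (x (m + n)) - x (m + n + 1) with ha
  have haC : ∀ m n, ‖a m n‖ ≤ ε / (S + 1) := fun m n => hx _
  set u : ℤ → E := fun m => ∑' n, ((T.symm : E →L[ℂ] E) ^ (n + 1)) (a m n) with hu
  have hrec : ∀ m, x (m + 1) - u (m + 1) = T (x m - u m) := by
    intro m
    have := map_tsum_symm_pow_succ hT (haC m)
    rw [map_sub]
    simp only [hu]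
    rw [this]
    have h1 : ∀ n : ℕ, a m (n + 1) = a (m + 1) n := by
      intro n
      simp only [ha]
      push_cast
      rw [show m + ((n : ℤ) + 1) = m + 1 + n by ring]
    simp only [h1]
    rw [show a m 0 = T (x m) - x (m + 1) by simp [ha]]
    abel
  have horb : ∀ n : ℤ, (T ^ n) (x 0 - u 0) = x n - u n := by
    intro n
    induction n using Int.induction_on with
    | zero => rfl
    | succ n ih => rw [zpow_add_one_apply, ih, hrec]
    | pred n ih =>
      apply T.injective
      rw [← zpow_add_one_apply, ← hrec, sub_add_cancel, ih]
  refine ⟨x 0 - u 0, fun n => ?_⟩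
  rw [horb, sub_sub_cancel_left, norm_neg]
  refine (norm_tsum_symm_pow_succ_le hT (haC n)).trans_lt ?_
  rw [← hS, ← mul_div_assoc, div_lt_iff₀ (by positivity)]
  nlinarith

end Abstract

/-! ### Structural stability from summable inverse powers -/

section Conjugacy

variable {E : Type*} [NormedAddCommGroup E] [NormedSpace ℂ E]

/-- Iterating `d = T⁻¹ (ψ + d ∘ g)` produces a series in `ψ` and a remainder `T^(-N) (d ∘ g^N)` that
vanishes in the limit. The bound does not involve `C`, so it yields both uniqueness (`M = 0`) and
contraction estimates. -/
theorem norm_le_of_cohomological {T : E ≃L[ℂ] E}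
    (hT : Summable fun n => ‖(T.symm : E →L[ℂ] E) ^ n‖) {g d ψ : E → E} {C M : ℝ}
    (hd : ∀ x, ‖d x‖ ≤ C) (hψ : ∀ x, ‖ψ x‖ ≤ M) (h : ∀ x, T (d x) = ψ x + d (g x)) (x : E) :
    ‖d x‖ ≤ (∑' n, ‖(T.symm : E →L[ℂ] E) ^ (n + 1)‖) * M := by
  have hM : 0 ≤ M := (norm_nonneg _).trans (hψ 0)
  have hiter : ∀ N, d x = ∑ n ∈ Finset.range N, ((T.symm : E →L[ℂ] E) ^ (n + 1)) (ψ (g^[n] x)) +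
      ((T.symm : E →L[ℂ] E) ^ N) (d (g^[N] x)) := by
    intro N
    induction N with
    | zero => simp
    | succ N ih =>
      rw [Finset.sum_range_succ, Function.iterate_succ_apply', add_assoc, ← map_add, ← h,
        pow_succ_symm_apply', T.symm_apply_apply]
      exact ih
  have hb : ∀ N, ‖d x‖ ≤ (∑' n, ‖(T.symm : E →L[ℂ] E) ^ (n + 1)‖) * M +
      ‖(T.symm : E →L[ℂ] E) ^ N‖ * C := by
    intro N
    rw [hiter N]
    refine (norm_add_le _ _).trans (add_le_add ?_ ?_)
    · refine (norm_sum_le _ _).trans ?_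
      calc _ ≤ ∑ n ∈ Finset.range N, ‖(T.symm : E →L[ℂ] E) ^ (n + 1)‖ * M :=
            Finset.sum_le_sum fun n _ => (ContinuousLinearMap.le_opNorm _ _).trans
              (mul_le_mul_of_nonneg_left (hψ _) (norm_nonneg _))
        _ ≤ _ := by
            rw [← Finset.sum_mul]
            exact mul_le_mul_of_nonneg_right (((summable_nat_add_iff 1).2 hT).sum_le_tsum _
              fun _ _ => norm_nonneg _) hM
    · exact (ContinuousLinearMap.le_opNorm _ _).trans
        (mul_le_mul_of_nonneg_left (hd _) (norm_nonneg _))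
  have hlim := (hT.tendsto_atTop_zero.mul_const C).const_add
    ((∑' n, ‖(T.symm : E →L[ℂ] E) ^ (n + 1)‖) * M)
  rw [zero_mul, add_zero] at hlim
  exact ge_of_tendsto' hlim hb

variable [CompleteSpace E]

theorem exists_cohomological_solution {T : E ≃L[ℂ] E}
    (hT : Summable fun n => ‖(T.symm : E →L[ℂ] E) ^ n‖) {g : E → E} (hg : Continuous g)
    (ψ : E →ᵇ E) : ∃ b : E →ᵇ E, ∀ x, T (b x) = ψ x + b (g x) := by
  have hψ : ∀ x (n : ℕ), ‖ψ (g^[n] x)‖ ≤ ‖ψ‖ := fun x n => ψ.norm_coe_le_norm _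
  refine ⟨BoundedContinuousFunction.ofNormedAddCommGroup
    (fun x => ∑' n, ((T.symm : E →L[ℂ] E) ^ (n + 1)) (ψ (g^[n] x))) ?_ _
      fun x => norm_tsum_symm_pow_succ_le hT (hψ x), fun x => ?_⟩
  · refine continuous_tsum (u := fun n => ‖(T.symm : E →L[ℂ] E) ^ (n + 1)‖ * ‖ψ‖)
      (fun n => (ContinuousLinearMap.continuous _).comp (ψ.continuous.comp (hg.iterate n)))
      (((summable_nat_add_iff 1).2 hT).mul_right _)
      fun n x => (ContinuousLinearMap.le_opNorm _ _).trans
        (mul_le_mul_of_nonneg_left (hψ x n) (norm_nonneg _))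
  · exact map_tsum_symm_pow_succ hT (hψ x)

/-- For `h = id + u`, this equation is `h ∘ T = (T + φ) ∘ h`. Freezing `u` inside `φ` leaves a
linear cohomological equation, whose solution map is a contraction with constant `S * ε`. -/
theorem exists_semiconjugacy {T : E ≃L[ℂ] E}
    (hT : Summable fun n => ‖(T.symm : E →L[ℂ] E) ^ n‖) {ε : ℝ≥0} {φ : E →ᵇ E}
    (hφ : LipschitzWith ε φ) (hε : (∑' n, ‖(T.symm : E →L[ℂ] E) ^ (n + 1)‖) * ε < 1) :
    ∃ u : E →ᵇ E, ∀ x, T (u x) = -φ (x + u x) + u (T x) := by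
  set S := ∑' n, ‖(T.symm : E →L[ℂ] E) ^ (n + 1)‖ with hS
  have hS0 : 0 ≤ S := tsum_nonneg fun _ => norm_nonneg _
  choose P hP using exists_cohomological_solution hT T.continuous
  let Φ : (E →ᵇ E) → (E →ᵇ E) := fun u => P (-φ.compContinuous ⟨fun x => x + u x, by fun_prop⟩)
  have hΦ : ∀ u x, T (Φ u x) = -φ (x + u x) + Φ u (T x) := fun u x => hP _ x
  have hlip : LipschitzWith (S.toNNReal * ε) Φ := by
    refine LipschitzWith.of_dist_le_mul fun u v => ?_
    rw [dist_eq_norm, dist_eq_norm, NNReal.coe_mul, Real.coe_toNNReal _ hS0, mul_assoc]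
    refine (BoundedContinuousFunction.norm_le (by positivity)).2 fun x => ?_
    refine norm_le_of_cohomological hT (g := T) (ψ := fun x => -φ (x + u x) + φ (x + v x))
      (C := ‖Φ u - Φ v‖) (d := fun x => (Φ u - Φ v) x)
      (fun x => BoundedContinuousFunction.norm_coe_le_norm _ _) (fun x => ?_) (fun x => ?_) x
    · have := hφ.dist_le_mul (x + v x) (x + u x)
      rw [dist_eq_norm, dist_eq_norm, add_sub_add_left_eq_sub, norm_sub_rev (v x)] at this
      rw [neg_add_eq_sub]
      exact this.trans (mul_le_mul_of_nonneg_left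
        ((u - v).norm_coe_le_norm x) ε.2)
    · simp only [BoundedContinuousFunction.coe_sub, Pi.sub_apply, map_sub, hΦ]
      abel
  have hcon : ContractingWith (S.toNNReal * ε) Φ := by
    refine ⟨?_, hlip⟩
    rw [← NNReal.coe_lt_coe, NNReal.coe_mul, Real.coe_toNNReal _ hS0]
    exact hε
  obtain ⟨u, hu⟩ : ∃ u, Φ u = u := ⟨_, hcon.fixedPoint_isFixedPt⟩
  exact ⟨u, fun x => by have := hΦ u x; rwa [hu] at this⟩

/-- The inverse `k = id + v` must satisfy `k ∘ (T + φ) = T ∘ k`, which is linear in `v` and needs no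
fixed point. Then `k ∘ h` commutes with `T` and is the identity by uniqueness, while `h ∘ k = id +
d` commutes with `T + φ`, which gives `‖d‖ ≤ S ε ‖d‖` and `d = 0`. -/
theorem stronglyStructurallyStable_of_summable {T : E ≃L[ℂ] E}
    (hT : Summable fun n => ‖(T.symm : E →L[ℂ] E) ^ n‖) : StronglyStructurallyStable T := by
  intro γ hγ
  set S := ∑' n, ‖(T.symm : E →L[ℂ] E) ^ (n + 1)‖ with hS
  have hS0 : 0 ≤ S := tsum_nonneg fun _ => norm_nonneg _
  -- This makes `S * ε` at most `γ`, for the distance to the identity, and at most `1/2`, for the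
  -- contraction.
  have hε0 : 0 < min γ (1 / 2) / (S + 1) := by positivity
  refine ⟨⟨_, hε0.le⟩, hε0, fun φ hφn hφ => ?_⟩
  set ε : ℝ≥0 := ⟨min γ (1 / 2) / (S + 1), hε0.le⟩ with hεdef
  have hSε : S * ε ≤ min γ (1 / 2) := by
    change S * (min γ (1 / 2) / (S + 1)) ≤ _
    rw [← mul_div_assoc, div_le_iff₀ (by positivity)]
    have : 0 < min γ (1 / 2) := by positivity
    nlinarith
  have hSε1 : S * ε < 1 := hSε.trans_lt ((min_le_right _ _).trans_lt (by norm_num))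
  obtain ⟨u, hu⟩ := exists_semiconjugacy hT hφ hSε1
  obtain ⟨v, hv⟩ := exists_cohomological_solution hT (g := fun x => T x + φ x)
    (by fun_prop) φ
  have hh : ∀ x, T x + u (T x) = T (x + u x) + φ (x + u x) := fun x => by
    rw [map_add, hu]; abel
  have hk : ∀ x, (T x + φ x) + v (T x + φ x) = T (x + v x) := fun x => by
    rw [map_add T, hv]; abel
  have hkh : ∀ x, u x + v (x + u x) = 0 := by
    intro x
    have := norm_le_of_cohomological hT (g := T) (ψ := fun _ => 0) (C := ‖u‖ + ‖v‖) (M := 0)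
      (d := fun x => u x + v (x + u x))
      (fun x => (norm_add_le _ _).trans (add_le_add (u.norm_coe_le_norm _) (v.norm_coe_le_norm _)))
      (fun x => by simp) (fun x => by
        have h1 := hk (x + u x)
        rw [← hh] at h1
        rw [zero_add]
        have h2 : T (x + u x + v (x + u x)) = T x + T (u x + v (x + u x)) := by
          rw [← map_add, add_assoc]
        rw [h2, add_assoc] at h1
        exact (add_left_cancel h1).symm) x
    simpa using this
  let d : E →ᵇ E := v + u.compContinuous ⟨fun x => x + v x, by fun_prop⟩
  have hd : ∀ x, d x = v x + u (x + v x) := fun _ => rfl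
  have hhk : d = 0 := by
    have hb : ‖d‖ ≤ S * (ε * ‖d‖) := by
      refine (BoundedContinuousFunction.norm_le (by positivity)).2 ?_
      refine norm_le_of_cohomological hT (g := fun x => T x + φ x)
        (ψ := fun x => φ x - φ (x + d x)) (C := ‖d‖) d.norm_coe_le_norm (fun x => ?_) fun x => ?_
      · have := hφ.dist_le_mul x (x + d x)
        rw [dist_eq_norm, dist_eq_norm, sub_add_cancel_left, norm_neg] at this
        exact this.trans (mul_le_mul_of_nonneg_left (d.norm_coe_le_norm x) ε.2)
      · have h1 := hh (x + v x)
        rw [← hk, add_assoc x, ← hd, add_assoc (T x + φ x), ← hd, map_add T, add_assoc (T x),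
          add_assoc (T x)] at h1
        have h2 := add_left_cancel h1
        rw [← sub_eq_iff_eq_add] at h2
        rw [← h2]; abel
    rw [← mul_assoc] at hb
    rw [← norm_eq_zero]
    nlinarith [norm_nonneg d]
  refine ⟨⟨⟨fun x => x + u x, fun x => x + v x, fun x => ?_, fun x => ?_⟩, ?_, ?_⟩, hh, fun x => ?_⟩
  · dsimp only; rw [add_assoc, hkh, add_zero]
  · dsimp only; rw [add_assoc, ← hd, hhk]; simp
  · dsimp only; fun_prop
  · dsimp only; fun_prop
  · change ‖x + u x - x‖ ≤ γ
    rw [add_sub_cancel_left]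
    refine (norm_le_of_cohomological hT (g := T) (ψ := fun x => -φ (x + u x)) (C := ‖u‖)
      (M := ε) u.norm_coe_le_norm (fun x => ?_) hu x).trans (hSε.trans (min_le_left _ _))
    rw [norm_neg]
    exact (φ.norm_coe_le_norm _).trans hφn

end Conjugacy

/-! ### Structural stability yields bounded solutions -/

section Perturbation

variable {E : Type*} [NormedAddCommGroup E] [NormedSpace ℂ E]

/-- Tents of radius `1` at centres `2` apart do not overlap, so comparing two points involves at
most two tents, whence the factor `2` in the Lipschitz constant. Separation from every `x m`, also
with `m ∉ s`, makes the map vanish where `z` does. -/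
theorem exists_bump_interpolation (s : Finset ℤ) (x z : ℤ → E) {δ : ℝ≥0}
    (hsep : ∀ n ∈ s, ∀ m, m ≠ n → 2 ≤ ‖x m - x n‖) (hz : ∀ n, ‖z n‖ ≤ δ)
    (hs : ∀ n, n ∉ s → z n = 0) :
    ∃ φ : E →ᵇ E, (∀ n, φ (x n) = z n) ∧ ‖φ‖ ≤ δ ∧ LipschitzWith (2 * δ) φ := by
  classical
  set b : ℤ → E → ℝ := fun n y => max (1 - ‖y - x n‖) 0 with hb
  have hb0 : ∀ n y, 0 ≤ b n y := fun n y => le_max_right _ _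
  have hb1 : ∀ n y, b n y ≤ 1 := fun n y => max_le (by linarith [norm_nonneg (y - x n)]) zero_le_one
  have hbl : ∀ n y y', |b n y - b n y'| ≤ ‖y - y'‖ := by
    intro n y y'
    refine (abs_max_sub_max_le_abs _ _ _).trans ?_
    rw [sub_sub_sub_cancel_left, abs_sub_comm]
    refine (abs_norm_sub_norm_le _ _).trans ?_
    rw [sub_sub_sub_cancel_right]
  have hone : ∀ y, ∃ i, ∀ n ∈ s, n ≠ i → b n y = 0 := by
    intro y
    by_cases h : ∃ i ∈ s, b i y ≠ 0
    · obtain ⟨i, his, hi⟩ := h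
      refine ⟨i, fun n hn hni => max_eq_right ?_⟩
      have h1 : ‖y - x i‖ < 1 := by
        by_contra hge
        exact hi (max_eq_right (by linarith))
      have h2 := hsep i his n hni
      have h3 : ‖x n - x i‖ ≤ ‖y - x n‖ + ‖y - x i‖ := by
        rw [norm_sub_rev y (x n), ← sub_add_sub_cancel (x n) y (x i)]
        exact norm_add_le _ _
      linarith
    · push Not at h
      exact ⟨0, fun n hn _ => h n hn⟩
  set F : E → E := fun y => ∑ n ∈ s, b n y • z n with hF
  have hFl : LipschitzWith (2 * δ) F := by
    refine LipschitzWith.of_dist_le_mul fun y y' => ?_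
    obtain ⟨i, hi⟩ := hone y
    obtain ⟨j, hj⟩ := hone y'
    rw [dist_eq_norm, dist_eq_norm]
    simp only [hF]
    rw [← Finset.sum_sub_distrib]
    simp only [← sub_smul]
    have hsub : ∑ n ∈ s, ‖(b n y - b n y') • z n‖ ≤
        ∑ n ∈ ({i, j} : Finset ℤ), ‖(b n y - b n y') • z n‖ := by
      rw [← Finset.sum_filter_add_sum_filter_not s (· ∈ ({i, j} : Finset ℤ)),
        Finset.sum_eq_zero (s := s.filter (· ∉ ({i, j} : Finset ℤ))), add_zero]
      · refine Finset.sum_le_sum_of_subset_of_nonneg ?_ fun _ _ _ => norm_nonneg _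
        exact fun n hn => (Finset.mem_filter.1 hn).2
      · intro n hn
        simp only [Finset.mem_filter, Finset.mem_insert, Finset.mem_singleton, not_or] at hn
        rw [hi n hn.1 hn.2.1, hj n hn.1 hn.2.2]
        simp
    refine (norm_sum_le _ _).trans (hsub.trans ?_)
    have hterm : ∀ n ∈ ({i, j} : Finset ℤ), ‖(b n y - b n y') • z n‖ ≤ ‖y - y'‖ * δ := by
      intro n _
      rw [norm_smul, Real.norm_eq_abs]
      exact mul_le_mul (hbl n y y') (hz n) (norm_nonneg _) (norm_nonneg _)
    refine (Finset.sum_le_card_nsmul _ _ _ hterm).trans ?_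
    rw [nsmul_eq_mul]
    have hcard : ((({i, j} : Finset ℤ).card : ℕ) : ℝ) ≤ 2 := by exact_mod_cast Finset.card_le_two
    calc _ ≤ 2 * (‖y - y'‖ * δ) := mul_le_mul_of_nonneg_right hcard (by positivity)
      _ = _ := by push_cast; ring
  have hFb : ∀ y, ‖F y‖ ≤ δ := by
    intro y
    obtain ⟨i, hi⟩ := hone y
    have : F y = if i ∈ s then b i y • z i else 0 := by
      split_ifs with his
      · exact Finset.sum_eq_single_of_mem i his fun n hn hni => by rw [hi n hn hni, zero_smul]
      · exact Finset.sum_eq_zero fun n hn => by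
          rw [hi n hn (by rintro rfl; exact his hn), zero_smul]
    rw [this]
    split_ifs
    · rw [norm_smul, Real.norm_of_nonneg (hb0 i y)]
      exact (mul_le_of_le_one_left (norm_nonneg _) (hb1 i y)).trans (hz i)
    · simp
  refine ⟨BoundedContinuousFunction.ofNormedAddCommGroup F hFl.continuous δ hFb, fun m => ?_,
    BoundedContinuousFunction.norm_ofNormedAddCommGroup_le _ δ.2 hFb, hFl⟩
  change ∑ n ∈ s, b n (x m) • z n = z m
  have hoff : ∀ n ∈ s, n ≠ m → b n (x m) • z n = 0 := by
    intro n hn hnm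
    rw [show b n (x m) = 0 from max_eq_right (by linarith [hsep n hn m hnm.symm]), zero_smul]
  by_cases hm : m ∈ s
  · rw [Finset.sum_eq_single_of_mem m hm hoff]
    simp [hb]
  · rw [hs m hm]
    exact Finset.sum_eq_zero fun n hn => hoff n hn (by rintro rfl; exact hm hn)

variable {F : Type*} [NormedAddCommGroup F] [NormedSpace ℂ F]

/-- The vectors whose two-sided orbit is eventually killed by `P`. -/
def wanderingSubmodule (T : E ≃L[ℂ] E) (P : E →L[ℂ] F) : Submodule ℂ E where
  carrier := {x | {k : ℤ | P ((T ^ k) x) ≠ 0}.Finite}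
  add_mem' {x y} hx hy := (hx.union hy).subset fun k hk => by
    by_contra h
    simp only [Set.mem_union, Set.mem_ofPred_eq, not_or, not_not] at h
    exact hk (by rw [map_add, map_add, h.1, h.2, add_zero])
  zero_mem' := by simp
  smul_mem' c x hx := hx.subset fun k hk => by
    simp only [Set.mem_ofPred_eq, map_smul] at hk ⊢
    exact fun h => hk (by rw [h, smul_zero])

theorem zpow_mem_wanderingSubmodule {T : E ≃L[ℂ] E} {P : E →L[ℂ] F} {x : E}
    (hx : x ∈ wanderingSubmodule T P) (m : ℤ) : (T ^ m) x ∈ wanderingSubmodule T P := by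
  refine (Set.Finite.preimage (f := fun k : ℤ => k + m) (add_left_injective m).injOn hx).subset
    fun k hk => ?_
  simp only [Set.mem_preimage, Set.mem_ofPred_eq, zpow_add_apply] at hk ⊢
  exact hk

/-- Adding a large multiple of `T^n w` to a forced orbit separates its points, so a perturbation `φ`
can take the value `z n` at `x n`. The forced orbit becomes an orbit of `T + φ`, and the conjugacy
keeps it within `1` of an orbit of `T`. -/
theorem StronglyStructurallyStable.hasBoundedSolutions {T : E ≃L[ℂ] E}
    (h : StronglyStructurallyStable T) {P : E →L[ℂ] F} {w : E} (hw : P w ≠ 0)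
    (hTw : ∀ k : ℤ, k ≠ 0 → P ((T ^ k) w) = 0) :
    HasBoundedSolutions T (wanderingSubmodule T P : Set E) := by
  obtain ⟨ε, hε, h⟩ := h 1 one_pos
  refine ⟨(ε / 2 : ℝ≥0), by positivity, fun z hzfin hzD hzε => ?_⟩
  obtain ⟨s, hsfin, hsD, hs⟩ := exists_zpow_forced_orbit T z hzfin
  replace hsD : ∀ n, s n ∈ wanderingSubmodule T P := fun n =>
    (Submodule.span_le.2 (by rintro _ ⟨k, rfl⟩; exact zpow_mem_wanderingSubmodule (hzD k) _))
      (hsD n)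
  -- This is where the forcing must lie in the wandering subspace: the traces `P (T^k (s n))` are
  -- then bounded uniformly in `n` and `k`.
  have hfin : (⋃ v ∈ Set.range s, Set.range fun k : ℤ => P ((T ^ k) v)).Finite := by
    refine hsfin.biUnion ?_
    rintro _ ⟨n, rfl⟩
    refine (((hsD n).image fun k : ℤ => P ((T ^ k) (s n))).union (Set.finite_singleton 0)).subset ?_
    rintro _ ⟨k, rfl⟩
    by_cases hk : P ((T ^ k) (s n)) = 0
    · exact Or.inr hk
    · exact Or.inl ⟨k, hk, rfl⟩
  obtain ⟨C, hC⟩ := hfin.isBounded.exists_norm_le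
  replace hC : ∀ n k : ℤ, ‖P ((T ^ k) (s n))‖ ≤ C := fun n k =>
    hC _ (Set.mem_biUnion ⟨n, rfl⟩ ⟨k, rfl⟩)
  have hw' : 0 < ‖P w‖ := norm_pos_iff.2 hw
  obtain ⟨B, hB⟩ : ∃ B : ℝ, ∀ n ∈ hzfin.toFinset, ‖P ∘L ((T ^ (-n) : E ≃L[ℂ] E) : E →L[ℂ] E)‖ ≤ B :=
    ⟨∑ n ∈ hzfin.toFinset, ‖P ∘L ((T ^ (-n) : E ≃L[ℂ] E) : E →L[ℂ] E)‖, fun n hn =>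
      Finset.single_le_sum (f := fun n => ‖P ∘L ((T ^ (-n) : E ≃L[ℂ] E) : E →L[ℂ] E)‖)
        (fun _ _ => norm_nonneg _) hn⟩
  -- Under `P T^(-n)`, the difference `x m - x n` sees `t • P w` up to an error `2 * C`; what
  -- remains is `2 * |B|`, and dividing by the operator bound `B` leaves separation `2`.
  set t : ℝ := (2 * |B| + 2 * C) / ‖P w‖ with ht
  have hC0 : 0 ≤ C := (norm_nonneg _).trans (hC 0 0)
  have ht0 : 0 ≤ t := by positivity
  set x : ℤ → E := fun n => (T ^ n) (s n + (t : ℂ) • w) with hx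
  have hxrec : ∀ n, x (n + 1) = T (x n) + z n := fun n => hs n _
  have hsep : ∀ n ∈ hzfin.toFinset, ∀ m, m ≠ n → 2 ≤ ‖x m - x n‖ := by
    intro n hn m hmn
    have h1 : P ((T ^ (-n)) (x m - x n)) =
        P ((T ^ (-n + m)) (s m)) - P ((T ^ (0 : ℤ)) (s n)) - (t : ℂ) • P w := by
      simp only [hx, map_sub]
      rw [← zpow_add_apply, ← zpow_add_apply, neg_add_cancel, map_add, map_add, map_add, map_add,
        map_smul, map_smul, hTw (-n + m) (by omega)]
      simp only [smul_zero, zpow_zero, map_smul]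
      change _ - (P (s n) + (t : ℂ) • P w) = _ - P (s n) - _
      abel
    have h2 : 2 * |B| ≤ ‖P ((T ^ (-n)) (x m - x n))‖ := by
      rw [h1]
      have h3 := norm_sub_norm_le ((t : ℂ) • P w) (P ((T ^ (-n + m)) (s m)) - P ((T ^ (0 : ℤ)) (s n)))
      rw [norm_sub_rev ((t : ℂ) • P w), norm_smul, Complex.norm_real, Real.norm_of_nonneg ht0, ht,
        div_mul_cancel₀ _ hw'.ne'] at h3
      have h4 := norm_sub_le (P ((T ^ (-n + m)) (s m))) (P ((T ^ (0 : ℤ)) (s n)))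
      have := hC m (-n + m)
      have := hC n 0
      linarith
    have h5 : ‖P ((T ^ (-n)) (x m - x n))‖ ≤ B * ‖x m - x n‖ :=
      ((P ∘L ((T ^ (-n) : E ≃L[ℂ] E) : E →L[ℂ] E)).le_opNorm _).trans
        (mul_le_mul_of_nonneg_right (hB n hn) (norm_nonneg _))
    have hBpos : 0 < B := by
      have hne : P ∘L ((T ^ (-n) : E ≃L[ℂ] E) : E →L[ℂ] E) ≠ 0 := by
        intro h0
        have h6 := DFunLike.congr_fun h0 ((T ^ n) w)
        change P ((T ^ (-n)) ((T ^ n) w)) = 0 at h6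
        rw [← zpow_add_apply, neg_add_cancel, zpow_zero] at h6
        exact hw h6
      exact (norm_pos_iff.2 hne).trans_le (hB n hn)
    rw [abs_of_pos hBpos, mul_comm] at h2
    exact le_of_mul_le_mul_left (h2.trans h5) hBpos
  obtain ⟨φ, hφx, hφn, hφl⟩ := exists_bump_interpolation hzfin.toFinset x z hsep hzε
    fun n hn => by simpa using hn
  have hε2 : 2 * (ε / 2) = ε := mul_div_cancel₀ _ two_ne_zero
  rw [hε2] at hφl
  obtain ⟨H, hH, hHγ⟩ := h φ (hφn.trans (by exact_mod_cast half_le_self ε.2)) hφl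
  have horb : ∀ n : ℤ, H ((T ^ n) (H.symm (x 0))) = x n := by
    -- Following the orbit backwards requires injectivity of `T + φ`, inherited from `T` through the
    -- conjugacy.
    have hinj : Function.Injective fun y => T y + φ y := by
      intro y y' hyy
      have h1 : H (T (H.symm y)) = H (T (H.symm y')) := by
        rw [hH, hH, H.apply_symm_apply, H.apply_symm_apply]; exact hyy
      exact H.symm.injective (T.injective (H.injective h1))
    intro n
    induction n using Int.induction_on with
    | zero => exact H.apply_symm_apply _
    | succ n ih => rw [zpow_add_one_apply, hH, ih, hxrec, hφx]
    | pred n ih =>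
      apply hinj
      dsimp only
      rw [← hH, ← zpow_add_one_apply, sub_add_cancel, ih, hφx, ← hxrec, sub_add_cancel]
  refine ⟨fun n => x n - (T ^ n) (H.symm (x 0)), fun n => ?_, fun n => ?_⟩
  · dsimp only
    rw [← horb]
    exact hHγ _
  · dsimp only
    rw [hxrec, zpow_add_one_apply, map_sub]; abel

theorem stronglyStructurallyStable_iff_hasShadowingProperty [CompleteSpace E] {T : E ≃L[ℂ] E}
    (hT : PositivelyExpansive (T : E →L[ℂ] E)) {P : E →L[ℂ] F} {w : E} (hw : P w ≠ 0)
    (hTw : ∀ k : ℤ, k ≠ 0 → P ((T ^ k) w) = 0)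
    (hdense : Dense (wanderingSubmodule T P : Set E)) :
    StronglyStructurallyStable T ↔ HasShadowingProperty T := by
  have key : HasBoundedSolutions T (wanderingSubmodule T P : Set E) →
      Summable fun n => ‖(T.symm : E →L[ℂ] E) ^ n‖ := fun h =>
    h.summable_norm_symm_pow hT (fun x hx => by
      have := zpow_mem_wanderingSubmodule hx (-1)
      rwa [zpow_neg_one] at this) hdense
  exact ⟨fun h => hasShadowingProperty_of_summable (key (h.hasBoundedSolutions hw hTw)),
    fun h => stronglyStructurallyStable_of_summable (key (h.hasBoundedSolutions _))⟩

end Perturbation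

/-! ### Measures of the levels `f^k W` -/

section Iterates

variable {X : Type*} [MeasurableSpace X] {f : X ≃ᵐ X} {μ : Measure X} {W : Set X}

theorem zpow_add_one_toEquiv_apply (f : X ≃ᵐ X) (k : ℤ) (x : X) :
    ((f.toEquiv : Equiv.Perm X) ^ (k + 1)) x = ((f.toEquiv : Equiv.Perm X) ^ k) (f x) := by
  rw [zpow_add_one]; rfl

theorem zpow_add_one_toEquiv_apply' (f : X ≃ᵐ X) (k : ℤ) (x : X) :
    ((f.toEquiv : Equiv.Perm X) ^ (k + 1)) x = f (((f.toEquiv : Equiv.Perm X) ^ k) x) := by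
  rw [add_comm, zpow_one_add]; rfl

theorem iterImage_eq_preimage (f : X ≃ᵐ X) (k : ℤ) (A : Set X) :
    iterImage f k A = ((f.toEquiv : Equiv.Perm X) ^ (-k)) ⁻¹' A := by
  rw [iterImage, Equiv.image_eq_preimage_symm, zpow_neg]; rfl

theorem measurable_zpow_toEquiv (f : X ≃ᵐ X) (k : ℤ) :
    Measurable ((f.toEquiv : Equiv.Perm X) ^ k) := by
  induction k using Int.induction_on with
  | zero => exact measurable_id
  | succ n ih =>
    have : ⇑((f.toEquiv : Equiv.Perm X) ^ ((n : ℤ) + 1)) =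
        ⇑((f.toEquiv : Equiv.Perm X) ^ (n : ℤ)) ∘ f := funext fun x => by
      rw [zpow_add_one_toEquiv_apply]; rfl
    rw [this]
    exact ih.comp f.measurable
  | pred n ih =>
    have : ⇑((f.toEquiv : Equiv.Perm X) ^ (-(n : ℤ) - 1)) =
        ⇑((f.toEquiv : Equiv.Perm X) ^ (-(n : ℤ))) ∘ f.symm := funext fun x => by
      rw [zpow_sub_one]; rfl
    rw [this]
    exact ih.comp f.symm.measurable

theorem measurableSet_iterImage (f : X ≃ᵐ X) (k : ℤ) {A : Set X} (hA : MeasurableSet A) :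
    MeasurableSet (iterImage f k A) := by
  rw [iterImage_eq_preimage]
  exact measurable_zpow_toEquiv f _ hA

theorem iterImage_zero (f : X ≃ᵐ X) (A : Set X) : iterImage f 0 A = A := by
  simp [iterImage]

theorem iterImage_add (f : X ≃ᵐ X) (j k : ℤ) (A : Set X) :
    iterImage f (j + k) A = iterImage f j (iterImage f k A) := by
  rw [iterImage, iterImage, iterImage, zpow_add, Set.image_image]; rfl

theorem preimage_iterImage (f : X ≃ᵐ X) (k : ℤ) (A : Set X) :
    f ⁻¹' (iterImage f k A) = iterImage f (k - 1) A := by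
  rw [show k - 1 = -1 + k by ring, iterImage_add, iterImage_eq_preimage f (-1), neg_neg, zpow_one]
  rfl

theorem IsDissipativeSystem.measure_iterImage_eq_zero_iff (h : IsDissipativeSystem f μ W) (k : ℤ)
    {B : Set X} (hB : MeasurableSet B) : μ (iterImage f k B) = 0 ↔ μ B = 0 := by
  induction k using Int.induction_on with
  | zero => rw [iterImage_zero]
  | succ n ih =>
    rw [← ih, ← h.nonsingular _ (measurableSet_iterImage f _ hB), preimage_iterImage,
      add_sub_cancel_right]
  | pred n ih =>
    rw [← preimage_iterImage, h.nonsingular _ (measurableSet_iterImage f _ hB), ih]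

theorem IsDissipativeSystem.quasiMeasurePreserving_zpow (h : IsDissipativeSystem f μ W) (k : ℤ) :
    Measure.QuasiMeasurePreserving ((f.toEquiv : Equiv.Perm X) ^ k) μ μ := by
  refine ⟨measurable_zpow_toEquiv f k, Measure.AbsolutelyContinuous.mk fun B hB h0 => ?_⟩
  rw [Measure.map_apply (measurable_zpow_toEquiv f k) hB,
    show ((f.toEquiv : Equiv.Perm X) ^ k) ⁻¹' B = iterImage f (-k) B by
      rw [iterImage_eq_preimage, neg_neg],
    h.measure_iterImage_eq_zero_iff _ hB]
  exact h0

theorem IsDissipativeSystem.measure_iterImage_pos (h : IsDissipativeSystem f μ W) (k : ℤ) :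
    μ (iterImage f k W) ≠ 0 :=
  fun h0 => h.measure_pos.ne' ((h.measure_iterImage_eq_zero_iff k h.measurableSet).1 h0)

/-- A level of infinite measure would contain, by σ-finiteness, a set `B` with `0 < μ B < ∞`; the
lower distortion bound for `f^(-k) B` would then make `μ B * μ W` infinite. -/
theorem IsDissipativeSystem.measure_iterImage_ne_top [SigmaFinite μ]
    (h : IsDissipativeSystem f μ W) (hd : HasBoundedDistortion f μ W) (k : ℤ) :
    μ (iterImage f k W) ≠ ∞ := by
  intro htop
  obtain ⟨B, hB, hBW, hB0, hBtop⟩ := Measure.exists_subset_measure_lt_top (r := 0)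
    (measurableSet_iterImage f k h.measurableSet) (by rw [htop]; simp)
  obtain ⟨K, hK, hd⟩ := hd
  have hCB : iterImage f k (iterImage f (-k) B) = B := by
    rw [← iterImage_add, add_neg_cancel, iterImage_zero]
  have hCW : iterImage f (-k) B ⊆ W := by
    have := Set.image_mono (f := ((f.toEquiv : Equiv.Perm X) ^ (-k))) hBW
    refine this.trans_eq ?_
    change iterImage f (-k) (iterImage f k W) = W
    rw [← iterImage_add, neg_add_cancel, iterImage_zero]
  have := (hd k _ (measurableSet_iterImage f (-k) hB) hCW).1
  have hC0 : μ (iterImage f (-k) B) ≠ 0 := fun h0 =>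
    hB0.ne' ((h.measure_iterImage_eq_zero_iff _ hB).1 h0)
  rw [hCB, htop, ENNReal.top_mul hC0, ENNReal.mul_top (by simp)] at this
  exact absurd (top_le_iff.1 this) (ENNReal.mul_lt_top hBtop h.measure_lt_top).ne

/-- The push-forward of `μ` under `f ^ n` dominates a multiple of `μ` on `f ^ k (W)`. -/
theorem IsDissipativeSystem.exists_smul_restrict_le_map [SigmaFinite μ]
    (h : IsDissipativeSystem f μ W) (hd : HasBoundedDistortion f μ W) (k : ℤ) :
    ∃ c : ℝ≥0∞, c ≠ 0 ∧ ∀ n : ℤ,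
      (c * μ (iterImage f (k - n) W)) • μ.restrict (iterImage f k W) ≤
        μ.map ((f.toEquiv : Equiv.Perm X) ^ n) := by
  have hak := h.measure_iterImage_pos k
  have haktop := h.measure_iterImage_ne_top hd k
  obtain ⟨K, hK, hd⟩ := hd
  have hK0 : (K : ℝ≥0∞) ≠ 0 := by exact_mod_cast hK.ne'
  -- One factor `K⁻¹` pays for the upper distortion bound at level `k`, the other for the lower
  -- bound at level `k - n`.
  refine ⟨(K : ℝ≥0∞)⁻¹ * ((K : ℝ≥0∞)⁻¹ * (μ (iterImage f k W))⁻¹), ?_, fun n => ?_⟩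
  · refine mul_ne_zero (by simp) (mul_ne_zero (by simp) (by simpa using haktop))
  refine Measure.le_iff.2 fun B hB => ?_
  rw [Measure.map_apply (measurable_zpow_toEquiv f n) hB, Measure.smul_apply, smul_eq_mul,
    Measure.restrict_apply hB]
  set B' := B ∩ iterImage f k W with hB'
  have hB'm : MeasurableSet B' := hB.inter (measurableSet_iterImage f k h.measurableSet)
  set C := iterImage f (-k) B' with hC
  have hCm : MeasurableSet C := measurableSet_iterImage f _ hB'm
  have hCB : iterImage f k C = B' := by
    rw [hC, ← iterImage_add, add_neg_cancel, iterImage_zero]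
  have hCW : C ⊆ W := by
    have := Set.image_mono (f := ((f.toEquiv : Equiv.Perm X) ^ (-k)))
      (Set.inter_subset_right : B' ⊆ iterImage f k W)
    refine this.trans_eq ?_
    change iterImage f (-k) (iterImage f k W) = W
    rw [← iterImage_add, neg_add_cancel, iterImage_zero]
  have h1 := (hd k C hCm hCW).2
  have h2 := (hd (k - n) C hCm hCW).1
  rw [hCB] at h1
  have hsub : iterImage f (k - n) C ⊆ ((f.toEquiv : Equiv.Perm X) ^ n) ⁻¹' B := by
    rw [show k - n = -n + k by ring, iterImage_add, hCB, iterImage_eq_preimage, neg_neg]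
    exact Set.preimage_mono Set.inter_subset_left
  refine le_trans ?_ (measure_mono hsub)
  rw [← ENNReal.mul_le_mul_iff_left h.measure_pos.ne' h.measure_lt_top.ne]
  refine le_trans ?_ h2
  set a := μ (iterImage f k W)
  set b := μ (iterImage f (k - n) W)
  calc (K : ℝ≥0∞)⁻¹ * ((K : ℝ≥0∞)⁻¹ * a⁻¹) * b * μ B' * μ W
      = (K : ℝ≥0∞)⁻¹ * ((K : ℝ≥0∞)⁻¹ * a⁻¹) * b * (μ B' * μ W) := by ring
    _ ≤ (K : ℝ≥0∞)⁻¹ * ((K : ℝ≥0∞)⁻¹ * a⁻¹) * b * (K * (a * μ C)) := by gcongr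
    _ = (K : ℝ≥0∞)⁻¹ * (b * μ C) * ((K : ℝ≥0∞)⁻¹ * K) * (a⁻¹ * a) := by ring
    _ = (K : ℝ≥0∞)⁻¹ * (b * μ C) := by
      rw [ENNReal.inv_mul_cancel hK0 ENNReal.coe_ne_top, ENNReal.inv_mul_cancel hak haktop,
        mul_one, mul_one]

end Iterates

/-! ### The composition operator on `L^p` -/

section LpOperators

variable {X : Type*} [MeasurableSpace X] {f : X ≃ᵐ X} {μ : Measure X} {W : Set X}
  {p : ℝ≥0∞} [Fact (1 ≤ p)] {hf : CompositionBounded f μ} {T : Lp ℂ p μ ≃L[ℂ] Lp ℂ p μ}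

theorem IsDissipativeSystem.zpow_ae_eq (h : IsDissipativeSystem f μ W)
    (hT : (T : Lp ℂ p μ →L[ℂ] Lp ℂ p μ) = compositionOperator p hf) (k : ℤ) (φ : Lp ℂ p μ) :
    (T ^ k) φ =ᵐ[μ] φ ∘ ⇑((f.toEquiv : Equiv.Perm X) ^ k) := by
  have hT1 : ∀ ψ : Lp ℂ p μ, T ψ =ᵐ[μ] ψ ∘ f := fun ψ => by
    have := compositionOperator_ae_eq p hf ψ
    rwa [← hT] at this
  induction k using Int.induction_on with
  | zero => rfl
  | succ n ih =>
    rw [zpow_add_one_apply]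
    refine (hT1 _).trans ((hf.quasiMeasurePreserving.ae_eq_comp ih).trans ?_)
    refine Filter.EventuallyEq.of_eq (funext fun x => ?_)
    rw [Function.comp_apply, Function.comp_apply, Function.comp_apply, zpow_add_one_toEquiv_apply]
  | pred n ih =>
    have h1 := hT1 ((T ^ (-(n : ℤ) - 1)) φ)
    rw [← zpow_add_one_apply, sub_add_cancel] at h1
    have h2 := (h.quasiMeasurePreserving_zpow (-1)).ae_eq_comp (h1.symm.trans ih)
    have h3 : ∀ x, f (((f.toEquiv : Equiv.Perm X) ^ (-1 : ℤ)) x) = x := fun x => by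
      rw [← zpow_add_one_toEquiv_apply', neg_add_cancel]; rfl
    filter_upwards [h2] with x hx
    simp only [Function.comp_apply, h3] at hx ⊢
    rw [hx, zpow_sub_one]
    rfl

theorem IsDissipativeSystem.eLpNorm_zpow (h : IsDissipativeSystem f μ W)
    (hT : (T : Lp ℂ p μ →L[ℂ] Lp ℂ p μ) = compositionOperator p hf) (k : ℤ) (φ : Lp ℂ p μ) :
    eLpNorm ((T ^ k) φ) p μ = eLpNorm φ p (μ.map ((f.toEquiv : Equiv.Perm X) ^ k)) := by
  have hq := h.quasiMeasurePreserving_zpow k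
  rw [eLpNorm_congr_ae (h.zpow_ae_eq hT k φ), eLpNorm_map_measure
    ((Lp.aestronglyMeasurable φ).mono_ac hq.absolutelyContinuous) hq.measurable.aemeasurable]

/-- Starting from level `k` instead of `0` omits at most finitely many negative levels, each of
finite measure, so unboundedness survives. -/
theorem exists_measure_iterImage_gt (hfin : ∀ k, μ (iterImage f k W) ≠ ∞)
    (hsup : (⨆ (n : ℕ) (_ : 1 ≤ n), μ (iterImage f (-(n : ℤ)) W)) = ∞) (k : ℤ) {R : ℝ≥0∞}
    (hR : R ≠ ∞) : ∃ n : ℕ, 1 ≤ n ∧ R < μ (iterImage f (k - n) W) := by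
  by_contra! hle
  refine absurd hsup (ne_top_of_le_ne_top (b := R + ∑ i ∈ Finset.range (k.natAbs + 1),
    μ (iterImage f (-(i : ℤ)) W)) ?_ ?_)
  · exact ENNReal.add_ne_top.2 ⟨hR, ENNReal.sum_ne_top.2 fun _ _ => hfin _⟩
  · refine iSup₂_le fun m hm => ?_
    by_cases hmk : m < k.natAbs + 1
    · exact le_add_left (Finset.single_le_sum (f := fun i : ℕ => μ (iterImage f (-(i : ℤ)) W))
        (fun _ _ => zero_le) (Finset.mem_range.2 hmk))
    · have := hle (k + m).toNat (by omega)
      rw [show k - ((k + m).toNat : ℤ) = -m by omega] at this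
      exact le_add_right this

theorem IsDissipativeSystem.positivelyExpansive_of_iSup_eq_top [SigmaFinite μ] (hp : p ≠ ∞)
    (h : IsDissipativeSystem f μ W) (hd : HasBoundedDistortion f μ W)
    (hT : (T : Lp ℂ p μ →L[ℂ] Lp ℂ p μ) = compositionOperator p hf)
    (hsup : (⨆ (n : ℕ) (_ : 1 ≤ n), μ (iterImage f (-(n : ℤ)) W)) = ∞) :
    PositivelyExpansive (T : Lp ℂ p μ →L[ℂ] Lp ℂ p μ) := by
  have hp0 : p ≠ 0 := (zero_lt_one.trans_le Fact.out).ne'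
  have hpr : 0 < p.toReal := ENNReal.toReal_pos hp0 hp
  intro φ hφ
  obtain ⟨k, hk⟩ : ∃ k : ℤ, eLpNorm φ p (μ.restrict (iterImage f k W)) ≠ 0 := by
    by_contra! hk
    have h0 : (φ : X → ℂ) =ᵐ[μ.restrict (⋃ k : ℤ, iterImage f k W)] 0 :=
      (ae_restrict_iUnion_iff _ _).2 fun k =>
        (eLpNorm_eq_zero_iff (Lp.aestronglyMeasurable φ).restrict hp0).1 (hk k)
    rw [h.iUnion_eq, Measure.restrict_univ] at h0
    rw [(Lp.eq_zero_iff_ae_eq_zero).2 h0, norm_zero] at hφ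
    exact zero_ne_one hφ
  set e := eLpNorm φ p (μ.restrict (iterImage f k W)) with he
  obtain ⟨c, hc0, hc⟩ := h.exists_smul_restrict_le_map hd k
  -- The threshold is the one at which `(c * a (k - n))^(1/p) * e` reaches `2`.
  obtain ⟨n, hn, hR⟩ := exists_measure_iterImage_gt (h.measure_iterImage_ne_top hd) hsup k
    (R := c⁻¹ * (2 * e⁻¹) ^ p.toReal) (ENNReal.mul_ne_top (by simpa using hc0)
      (ENNReal.rpow_ne_top_of_nonneg hpr.le
        (ENNReal.mul_ne_top ENNReal.ofNat_ne_top (by simpa using hk))))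
  refine ⟨n, hn, ?_⟩
  have hetop : e ≠ ∞ := ((Lp.memLp φ).restrict _).2.ne
  have hctop : c ≠ ∞ := by
    rintro rfl
    have h1 := Measure.le_iff'.1 (hc 0) (iterImage f k W)
    rw [sub_zero, ENNReal.top_mul (h.measure_iterImage_pos k), Measure.smul_apply, smul_eq_mul,
      Measure.restrict_apply_self, ENNReal.top_mul (h.measure_iterImage_pos k), zpow_zero,
      Equiv.Perm.coe_one, Measure.map_id] at h1
    exact h.measure_iterImage_ne_top hd k (top_le_iff.1 h1)
  have hle : 2 ≤ eLpNorm ((T ^ (n : ℤ)) φ) p μ := by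
    rw [h.eLpNorm_zpow hT]
    refine le_trans ?_ (eLpNorm_mono_measure φ (hc n))
    rw [eLpNorm_smul_measure_of_ne_top hp, smul_eq_mul, ← he, one_div, ENNReal.toReal_inv]
    have h1 : (2 * e⁻¹) ^ p.toReal ≤ c * μ (iterImage f (k - n) W) := by
      calc (2 * e⁻¹) ^ p.toReal = c * (c⁻¹ * (2 * e⁻¹) ^ p.toReal) := by
            rw [← mul_assoc, ENNReal.mul_inv_cancel hc0 hctop, one_mul]
        _ ≤ _ := by gcongr
    calc (2 : ℝ≥0∞) = (2 * e⁻¹) * e := by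
          rw [mul_assoc, ENNReal.inv_mul_cancel hk hetop, mul_one]
      _ = ((2 * e⁻¹) ^ p.toReal) ^ p.toReal⁻¹ * e := by
          rw [ENNReal.rpow_rpow_inv hpr.ne']
      _ ≤ _ := by gcongr
  rw [← zpow_natCast_apply, Lp.norm_def]
  exact (ENNReal.toReal_mono (Lp.eLpNorm_ne_top _) hle)

theorem IsDissipativeSystem.iSup_eq_top_of_positivelyExpansive [SigmaFinite μ] (hp : p ≠ ∞)
    (h : IsDissipativeSystem f μ W) (hd : HasBoundedDistortion f μ W)
    (hT : (T : Lp ℂ p μ →L[ℂ] Lp ℂ p μ) = compositionOperator p hf)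
    (hpe : PositivelyExpansive (T : Lp ℂ p μ →L[ℂ] Lp ℂ p μ)) :
    (⨆ (n : ℕ) (_ : 1 ≤ n), μ (iterImage f (-(n : ℤ)) W)) = ∞ := by
  have hp1 : 1 ≤ p := Fact.out
  have hp0 : p ≠ 0 := (zero_lt_one.trans_le hp1).ne'
  have hpr : 1 ≤ p.toReal := by
    rw [← ENNReal.toReal_one]; exact ENNReal.toReal_mono hp hp1
  have hprec : 0 < 1 / p.toReal := by positivity
  by_contra hfin
  set a : ℤ → ℝ≥0∞ := fun k => μ (iterImage f k W) with ha
  have hafin : ∀ k, a k ≠ ∞ := h.measure_iterImage_ne_top hd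
  -- Level `0` is included, so that `M` is a supremum over all `j ≥ 0` and some `a (-j)` exceeds `M
  -- / 2`.
  set M : ℝ≥0∞ := ⨆ n : ℕ, a (-(n : ℤ)) with hM
  have hMtop : M ≠ ∞ := by
    refine ne_top_of_le_ne_top (ENNReal.add_ne_top.2 ⟨hafin 0, hfin⟩) (iSup_le fun n => ?_)
    rcases n.eq_zero_or_pos with rfl | hn
    · exact le_add_right (le_of_eq (by simp))
    · exact le_add_left (le_iSup₂_of_le n hn le_rfl)
  have hM0 : M ≠ 0 := fun h0 => h.measure_iterImage_pos 0 (le_zero_iff.1 (by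
    rw [← h0]; exact (le_of_eq (by simp [ha])).trans (le_iSup (fun n : ℕ => a (-(n : ℤ))) 0)))
  obtain ⟨j, hj⟩ := lt_iSup_iff.1 (ENNReal.half_lt_self hM0 hMtop)
  have hjm : MeasurableSet (iterImage f (-(j : ℤ)) W) := measurableSet_iterImage f _ h.measurableSet
  set v : Lp ℂ p μ := indicatorConstLp p hjm (hafin _) 1 with hv
  have hvn : ∀ n : ℤ, eLpNorm ((T ^ n) v) p μ = a (-j - n) ^ (1 / p.toReal) := by
    intro n
    have hset : iterImage f (-j - n) W =
        ((f.toEquiv : Equiv.Perm X) ^ n) ⁻¹' iterImage f (-(j : ℤ)) W := by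
      rw [show -(j : ℤ) - n = -n + -j by ring, iterImage_add, iterImage_eq_preimage f (-n), neg_neg]
    have h1 : (T ^ n) v =ᵐ[μ] (iterImage f (-j - n) W).indicator fun _ => (1 : ℂ) := by
      refine (h.zpow_ae_eq hT n v).trans
        (((h.quasiMeasurePreserving_zpow n).ae_eq_comp indicatorConstLp_coeFn).trans ?_)
      rw [hset]
      rfl
    rw [eLpNorm_congr_ae h1, eLpNorm_indicator_const
      (measurableSet_iterImage f _ h.measurableSet) hp0 hp]
    simp [ha]
  have hv0 : eLpNorm v p μ = a (-j) ^ (1 / p.toReal) := by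
    have := hvn 0
    rwa [zpow_zero, sub_zero] at this
  have hvne : v ≠ 0 := by
    intro h0
    rw [h0, eLpNorm_congr_ae (Lp.coeFn_zero ℂ p μ), eLpNorm_zero, eq_comm,
      ENNReal.rpow_eq_zero_iff_of_pos hprec] at hv0
    exact h.measure_iterImage_pos _ hv0
  obtain ⟨n, hn, hle⟩ := hpe.exists_two_mul_norm_le hvne
  rw [← zpow_natCast_apply, Lp.norm_def, Lp.norm_def, hvn, hv0] at hle
  have hlt : a (-j - n) < 2 * a (-j) := by
    have h1 : a (-j - n) ≤ M :=
      (le_of_eq (by rw [show -(j : ℤ) - n = -((j + n : ℕ) : ℤ) by push_cast; ring])).trans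
        (le_iSup (fun n : ℕ => a (-(n : ℤ))) (j + n))
    refine h1.trans_lt ?_
    rw [ENNReal.div_lt_iff (Or.inl two_ne_zero) (Or.inl ENNReal.ofNat_ne_top)] at hj
    rwa [mul_comm]
  -- The factor `2` in measure becomes `2^(1/p)` in norm, at most `2` because `p ≥ 1`.
  have hlt' : a (-j - n) ^ (1 / p.toReal) < 2 * a (-j) ^ (1 / p.toReal) := by
    refine (ENNReal.rpow_lt_rpow hlt hprec).trans_le ?_
    rw [ENNReal.mul_rpow_of_nonneg _ _ hprec.le]
    gcongr
    calc (2 : ℝ≥0∞) ^ (1 / p.toReal) ≤ 2 ^ (1 : ℝ) :=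
          ENNReal.rpow_le_rpow_of_exponent_le one_le_two ((div_le_one₀ (by positivity)).2 hpr)
      _ = 2 := ENNReal.rpow_one _
  have htop : 2 * a (-j) ^ (1 / p.toReal) ≠ ∞ :=
    ENNReal.mul_ne_top ENNReal.ofNat_ne_top (ENNReal.rpow_ne_top_of_nonneg hprec.le (hafin _))
  have := ENNReal.toReal_strict_mono htop hlt'
  rw [ENNReal.toReal_mul, ENNReal.toReal_ofNat] at this
  linarith

theorem IsDissipativeSystem.restrict_zpow_eq_zero (h : IsDissipativeSystem f μ W)
    (hT : (T : Lp ℂ p μ →L[ℂ] Lp ℂ p μ) = compositionOperator p hf) {φ : Lp ℂ p μ} {g : X → ℂ}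
    (hφ : φ =ᵐ[μ] g) {k : ℤ} (hg : ∀ x ∈ W, g (((f.toEquiv : Equiv.Perm X) ^ k) x) = 0) :
    LpToLpRestrictCLM X ℂ ℂ μ p W ((T ^ k) φ) = 0 := by
  rw [Lp.eq_zero_iff_ae_eq_zero]
  refine (LpToLpRestrictCLM_coeFn ℂ W _).trans ?_
  have h1 := (h.zpow_ae_eq hT k φ).trans ((h.quasiMeasurePreserving_zpow k).ae_eq_comp hφ)
  filter_upwards [ae_restrict_of_ae h1, ae_restrict_mem h.measurableSet] with x hx hxW
  rw [hx]
  exact hg x hxW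

theorem IsDissipativeSystem.eq_of_zpow_mem_iterImage (h : IsDissipativeSystem f μ W) {j k : ℤ}
    {x : X} (hx : x ∈ W) (hj : ((f.toEquiv : Equiv.Perm X) ^ k) x ∈ iterImage f j W) : j = k := by
  by_contra hjk
  exact Set.disjoint_left.1 (h.pairwise_disjoint j k hjk) hj ⟨x, hx, rfl⟩

/-- A function carried by the levels `|j| ≤ M` is seen on `W` by `T^k` only when `|k| ≤ M`. The
levels exhaust `X`, so every indicator of a set of finite measure is a limit of such functions, here
using `p < ∞`. -/
theorem IsDissipativeSystem.dense_wanderingSubmodule (hp : p ≠ ∞) (h : IsDissipativeSystem f μ W)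
    (hT : (T : Lp ℂ p μ →L[ℂ] Lp ℂ p μ) = compositionOperator p hf) :
    Dense (wanderingSubmodule T (LpToLpRestrictCLM X ℂ ℂ μ p W) : Set (Lp ℂ p μ)) := by
  set D := wanderingSubmodule T (LpToLpRestrictCLM X ℂ ℂ μ p W) with hD
  suffices hmem : ∀ φ : Lp ℂ p μ, φ ∈ D.topologicalClosure from fun φ => hmem φ
  refine Lp.induction hp _ (fun c s hs hμs => ?_) (fun φ ψ hφ hψ _ h1 h2 => add_mem h1 h2)
    D.isClosed_topologicalClosure
  rw [Lp.simpleFunc.coe_indicatorConst]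
  set U : ℕ → Set X := fun M => ⋃ k ∈ Finset.Icc (-(M : ℤ)) M, iterImage f k W with hU
  have hUm : ∀ M, MeasurableSet (U M) := fun M =>
    Finset.measurableSet_biUnion _ fun k _ => measurableSet_iterImage f k h.measurableSet
  have htm : ∀ M, MeasurableSet (s ∩ U M) := fun M => hs.inter (hUm M)
  have hμt : ∀ M, μ (s ∩ U M) ≠ ∞ := fun M =>
    ((measure_mono Set.inter_subset_left).trans_lt hμs).ne
  have hlim : Filter.Tendsto (fun M => μ (symmDiff (s ∩ U M) s)) Filter.atTop (nhds 0) := by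
    have hsymm : ∀ M, symmDiff (s ∩ U M) s = s \ U M := fun M => by
      rw [symmDiff_of_le Set.inter_subset_left, Set.sdiff_self_inter]
    simp only [hsymm]
    have := tendsto_measure_iInter_atTop (μ := μ) (s := fun M => s \ U M)
      (fun M => (hs.diff (hUm M)).nullMeasurableSet)
      (fun M N hMN => Set.sdiff_subset_sdiff_right
        (Set.biUnion_subset_biUnion_left fun k hk => by
          simp only [SetLike.mem_coe, Finset.mem_Icc] at hk ⊢; omega))
      ⟨0, ((measure_mono Set.sdiff_subset).trans_lt hμs).ne⟩
    have hempty : ⋂ M, s \ U M = ∅ := by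
      refine Set.eq_empty_of_forall_notMem fun x hx => ?_
      obtain ⟨k, hk⟩ := Set.mem_iUnion.1 (h.iUnion_eq.symm ▸ Set.mem_univ x :
        x ∈ ⋃ k : ℤ, iterImage f k W)
      refine (Set.mem_iInter.1 hx k.natAbs).2 ?_
      exact Set.mem_biUnion (by simp only [Finset.coe_Icc, Set.mem_Icc]; omega) hk
    rwa [hempty, measure_empty] at this
  refine mem_closure_of_tendsto (tendsto_indicatorConstLp_set (ht := htm) (hμt := hμt) hp hlim)
    (Filter.Eventually.of_forall fun M => ?_)
  refine (Set.finite_Icc (-(M : ℤ)) M).subset fun k hk => ?_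
  by_contra hkM
  refine hk (h.restrict_zpow_eq_zero hT indicatorConstLp_coeFn fun x hx => ?_)
  refine Set.indicator_of_notMem (fun hmem => hkM ?_) _
  obtain ⟨j, hj, hxj⟩ := Set.mem_iUnion₂.1 hmem.2
  rw [← h.eq_of_zpow_mem_iterImage hx hxj]
  exact Finset.mem_Icc.1 hj

/-- Here `P` is restriction to `W` and `w` the indicator of `W`: disjointness of the levels makes
`T^k w` vanish on `W` for `k ≠ 0`. -/
theorem IsDissipativeSystem.stronglyStructurallyStable_iff (hp : p ≠ ∞)
    (h : IsDissipativeSystem f μ W)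
    (hT : (T : Lp ℂ p μ →L[ℂ] Lp ℂ p μ) = compositionOperator p hf)
    (hpe : PositivelyExpansive (T : Lp ℂ p μ →L[ℂ] Lp ℂ p μ)) :
    StronglyStructurallyStable T ↔ HasShadowingProperty T := by
  refine stronglyStructurallyStable_iff_hasShadowingProperty hpe
    (P := LpToLpRestrictCLM X ℂ ℂ μ p W)
    (w := indicatorConstLp p h.measurableSet h.measure_lt_top.ne 1) ?_ (fun k hk => ?_)
    (h.dense_wanderingSubmodule hp hT)
  · intro h0
    rw [Lp.eq_zero_iff_ae_eq_zero] at h0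
    have h1 := (LpToLpRestrictCLM_coeFn ℂ W _).symm.trans h0
    have h2 : ∀ᵐ _ ∂μ.restrict W, False := by
      filter_upwards [h1, ae_restrict_of_ae (indicatorConstLp_coeFn (p := p) (c := (1 : ℂ))
        (hs := h.measurableSet) (hμs := h.measure_lt_top.ne)),
        ae_restrict_mem h.measurableSet] with x hx1 hx2 hxW
      rw [hx2, Set.indicator_of_mem hxW] at hx1
      exact one_ne_zero hx1
    rw [Filter.eventually_false_iff_eq_bot, ae_eq_bot, Measure.restrict_eq_zero] at h2
    exact h.measure_pos.ne' h2
  · refine h.restrict_zpow_eq_zero hT indicatorConstLp_coeFn fun x hx => ?_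
    refine Set.indicator_of_notMem (fun hmem => hk ?_) _
    rw [← iterImage_zero f W] at hmem
    exact (h.eq_of_zpow_mem_iterImage hx hmem).symm

end LpOperators

end LinearDynamics

theorem theoremC {X : Type*} [MeasurableSpace X] (μ : Measure X) [SigmaFinite μ]
    (f : X ≃ᵐ X) (W : Set X) (p : ℝ≥0∞) [Fact (1 ≤ p)] (hp : p ≠ ∞)
    (hf : CompositionBounded f μ)
    (hdiss : IsDissipativeSystem f μ W) (hdist : HasBoundedDistortion f μ W)
    (T : Lp ℂ p μ ≃L[ℂ] Lp ℂ p μ)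
    (hT : (T : Lp ℂ p μ →L[ℂ] Lp ℂ p μ) = compositionOperator p hf) :
    ((⨆ (n : ℕ) (_ : 1 ≤ n), μ (iterImage f (-(n : ℤ)) W)) = ∞ ↔
      PositivelyExpansive (compositionOperator p hf)) ∧
    ((⨆ (n : ℕ) (_ : 1 ≤ n), μ (iterImage f (-(n : ℤ)) W)) = ∞ →
      (StronglyStructurallyStable T ↔ HasShadowingProperty T)) := by
  have hexp := hdiss.positivelyExpansive_of_iSup_eq_top hp hdist hT
  refine ⟨?_, fun hsup => hdiss.stronglyStructurallyStable_iff hp hT (hexp hsup)⟩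
  rw [← hT]
  exact ⟨hexp, hdiss.iSup_eq_top_of_positivelyExpansive hp hdist hT⟩
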